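/- For positive integers $m,n$ and a divisor $d$ of $m$, let $$A(m,d,n)=\{(\theta_1,\dots,\theta_n)\in C_m^{\,n} : (\theta_1\theta_2\cdots\theta_n)^{m/d}=1\},$$ where $C_m$ is the cyclic group of order $m$, and let $G(m,d,n)=A(m,d,n)\rtimes \mathrm{Sym}(n)$, where $\mathrm{Sym}(n)$ acts by permuting the coordinates. For a finite group $G$, let $\mu(G)$ be the least non-negative integer $k$ such that $G$ embeds in $\mathrm{Sym}(k)$. **Theorem.** Let $p$ and $q$ be odd primes with $p>q$. Then $$\mu(G(p,p,q))=\begin{cases} pq & \text{if } q\ge 5, \text{ or if } q=3 \text{ and } p\equiv 2 \pmod 3,\\ 2p & \text{if } q=3 \text{ and } p\equiv 1 \pmod 3.\end{cases}$$ -/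

import Mathlib

/-- The minimal faithful permutation degree of a group `G`: the least natural number `n` such that
`G` embeds in the symmetric group on `n` letters. For a finite group this minimum is attained,
see `minPermDegree_isLeast`. -/
noncomputable def minPermDegree (G : Type*) [Group G] : ℕ :=
  sInf {n : ℕ | ∃ f : G →* Equiv.Perm (Fin n), Function.Injective f}

theorem minPermDegree_isLeast (G : Type*) [Group G] [Finite G] :
    IsLeast {n : ℕ | ∃ f : G →* Equiv.Perm (Fin n), Function.Injective f} (minPermDegree G) := by
  have hne : {n : ℕ | ∃ f : G →* Equiv.Perm (Fin n), Function.Injective f}.Nonempty :=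
    ⟨Nat.card G, ((Finite.equivFin G).permCongrHom.toMonoidHom).comp (MulAction.toPermHom G G),
      (Finite.equivFin G).permCongrHom.injective.comp MulAction.toPerm_injective⟩
  exact ⟨Nat.sInf_mem hne, fun _ hn => Nat.sInf_le hn⟩

/-- The group `A(m,p,n)`, for a divisor `p` of `m`: the tuples `θ` in the direct product of `n`
copies of the cyclic group `C_m` with `(θ₁ θ₂ ⋯ θₙ) ^ (m / p) = 1`. -/
def baseGroup (m p n : ℕ) : Subgroup (Fin n → Multiplicative (ZMod m)) where
  carrier := {θ | (∏ i, θ i) ^ (m / p) = 1}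
  one_mem' := by simp
  mul_mem' := by
    intro a b ha hb
    simp only [Set.mem_ofPred_eq, Pi.mul_apply, Finset.prod_mul_distrib, mul_pow] at *
    rw [ha, hb, one_mul]
  inv_mem' := by
    intro a ha
    simp only [Set.mem_ofPred_eq, Pi.inv_apply, Finset.prod_inv_distrib, inv_pow] at *
    rw [ha, inv_one]

theorem baseGroup_comp_perm {m p n : ℕ} (σ : Equiv.Perm (Fin n))
    {θ : Fin n → Multiplicative (ZMod m)} (hθ : θ ∈ baseGroup m p n) :
    (fun i => θ (σ i)) ∈ baseGroup m p n := by
  change (∏ i, θ (σ i)) ^ (m / p) = 1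
  rw [Equiv.prod_comp σ θ]
  exact hθ

/-- The action of the symmetric group on `A(m,p,n)` by permuting the coordinates: `σ` moves the
entry in position `i` to position `σ i`. -/
def permAction (m p n : ℕ) : Equiv.Perm (Fin n) →* MulAut (baseGroup m p n) where
  toFun σ :=
    { toFun := fun θ => ⟨fun i => θ.1 (σ⁻¹ i), baseGroup_comp_perm σ⁻¹ θ.2⟩
      invFun := fun θ => ⟨fun i => θ.1 (σ i), baseGroup_comp_perm σ θ.2⟩
      left_inv := fun θ => by ext i; simp
      right_inv := fun θ => by ext i; simp
      map_mul' := fun _ _ => rfl }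
  map_one' := rfl
  map_mul' := fun _ _ => rfl

/-- The monomial reflection group `G(m,p,n)`, for a divisor `p` of `m`: the semidirect product of
`A(m,p,n)` by `Sym(n)`, acting by permutation of the coordinates. -/
abbrev monomialReflectionGroup (m p n : ℕ) : Type :=
  baseGroup m p n ⋊[permAction m p n] Equiv.Perm (Fin n)

instance (m p n : ℕ) [NeZero m] : Finite (monomialReflectionGroup m p n) :=
  Finite.of_equiv _ SemidirectProduct.equivProd.symm

/-! ### Elements of order `q` acting on the orbits of a normal elementary abelian `p`-subgroup. -/

section NormalPSubgroup

open scoped Pointwise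

variable {G X : Type*} [Group G] [MulAction G X] [Finite X] {A : Subgroup G} [A.Normal]

/-! Lower bound `p * q`: suppose the group acts faithfully on fewer than `p * q` points, and let `c
^ q = 1`. Orbits of the base group `A` are blocks of size 1 or `p`. If `c` moved one of size `p`,
its `q` translates would be disjoint and fill `p * q` points. So `c` preserves it, normalizes the
point stabilizer `A_x`, and acts on the cyclic group `A ⧸ A_x` by a power map
(`exists_zpow_smul_eq`). By faithfulness `A` embeds in the product of these quotients, so such
elements act on `A` "diagonally": their actions commute, and are trivial if `q` is coprime to `p -
1`. But `Sym(q)` acts faithfully on `A` and contains a `q`-cycle, and two noncommuting ones when `q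
≥ 5`. The natural monomial action attains `p * q`.

For `q = 3` and `p ≡ 1 [MOD 3]`, a primitive cube root of unity in `ZMod p` diagonalizes the 3-cycle
on `A`. Its two eigenfunctionals, swapped by odd permutations, give a faithful action on two copies
of `ZMod p`. Fewer points are impossible because `A` contains `C_p × C_p`. -/

theorem smul_mem_orbit_of_pow_eq_one {p q : ℕ} (hq : q.Prime) {c : G} (hc : c ^ q = 1) {x : X}
    (hx : p ≤ Nat.card (MulAction.orbit A x)) (hX : Nat.card X < p * q) :
    c • x ∈ MulAction.orbit A x := by
  by_contra hcx
  have hB : MulAction.IsBlock G (MulAction.orbit A x) := MulAction.IsBlock.orbit_of_normal x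
  let T : Subgroup G := MulAction.stabilizer G (MulAction.orbit A x)
  have hxx : x ∈ MulAction.orbit A x := MulAction.mem_orbit_self x
  have hcT : c ∉ T := fun h => hcx <| by
    have h' : c • MulAction.orbit A x = MulAction.orbit A x := h
    rw [← h']
    exact Set.smul_mem_smul_set hxx
  have hpow : ∀ n : ℕ, 0 < n → n < q → c ^ n ∉ T := by
    intro n h0 hn h
    apply hcT
    have hcop : IsCoprime (n : ℤ) q :=
      Nat.isCoprime_iff_coprime.mpr (Nat.coprime_of_lt_prime h0.ne' hn hq).symm
    obtain ⟨a, b, hab⟩ := hcop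
    have : c = (c ^ n) ^ a * (c ^ q) ^ b := by
      rw [← zpow_natCast, ← zpow_natCast c q, ← zpow_mul, ← zpow_mul, ← zpow_add, mul_comm _ a,
        mul_comm _ b, hab, zpow_one]
    rw [this, hc, one_zpow, mul_one]
    exact T.zpow_mem h a
  -- The translates of the orbit by `c ^ i` for `i < q` are pairwise disjoint, as no `c ^ n` with `0
  -- < n < q` stabilizes the block.
  have key : ∀ i j : ℕ, i ≤ j → j < q → ∀ y ∈ MulAction.orbit A x, ∀ z ∈ MulAction.orbit A x,
      c ^ i • y = c ^ j • z → i = j := by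
    intro i j hij hj y hy z hz h
    by_contra hne
    refine hpow (j - i) (by omega) (by omega) ?_
    have h1 : c ^ (j - i) • z = y := by
      have : c ^ j = c ^ i * c ^ (j - i) := by rw [← pow_add]; congr 1; omega
      rw [this, mul_smul] at h
      exact (smul_left_cancel _ h).symm
    rcases hB.smul_eq_or_disjoint (c ^ (j - i)) with h2 | h2
    · exact h2
    · exact (Set.disjoint_left.mp h2 (Set.smul_mem_smul_set hz) (h1 ▸ hy)).elim
  let F : Fin q × MulAction.orbit A x → X := fun t => c ^ (t.1 : ℕ) • (t.2 : X)
  have hF : Function.Injective F := by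
    rintro ⟨i, y, hy⟩ ⟨j, z, hz⟩ h
    have h' : c ^ (i : ℕ) • y = c ^ (j : ℕ) • z := h
    have hij : (i : ℕ) = j := by
      rcases le_total (i : ℕ) j with hle | hle
      · exact key i j hle j.2 y hy z hz h'
      · exact (key j i hle i.2 z hz y hy h'.symm).symm
    obtain rfl := Fin.ext hij
    have := smul_left_cancel _ h'
    subst this
    rfl
  have := Nat.card_le_card_of_injective F hF
  rw [Nat.card_prod, Nat.card_fin, mul_comm] at this
  exact absurd hX (not_lt.mpr ((Nat.mul_le_mul_right q hx).trans this))

/-- An element normalizing the stabilizer of a point in an elementary abelian group acts on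
the orbit of this point as a power map. -/
theorem exists_zpow_smul_eq [IsMulCommutative A] {p q : ℕ} (hp : p.Prime) (hq : q.Prime)
    (hqp : q ≤ p) (hA : ∀ a ∈ A, a ^ p = 1) (hX : Nat.card X < p * q) {c : G} (hc : c ^ q = 1)
    (x : X) : ∃ l : ℤ, ∀ a ∈ A, (c * a * c⁻¹) • x = a ^ l • x := by
  have : Fact p.Prime := ⟨hp⟩
  have hPG : IsPGroup p A := fun a => ⟨1, by
    ext; simpa using hA a a.2⟩
  obtain ⟨n, hn⟩ := hPG.card_orbit x
  have hle : Nat.card (MulAction.orbit A x) < p ^ 2 :=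
    calc _ ≤ Nat.card X := Nat.card_le_card_of_injective _ Subtype.val_injective
      _ < p * q := hX
      _ ≤ p ^ 2 := by rw [sq]; exact Nat.mul_le_mul_left p hqp
  rw [hn] at hle
  have hn2 : n < 2 := (Nat.pow_lt_pow_iff_right hp.one_lt).mp hle
  have hconj : ∀ a ∈ A, c * a * c⁻¹ ∈ A := fun a ha => ‹A.Normal›.conj_mem a ha c
  obtain rfl | rfl : n = 0 ∨ n = 1 := by omega
  · have hfix : ∀ a ∈ A, a • x = x := by
      intro a ha
      rw [pow_zero, Nat.card_eq_one_iff_unique] at hn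
      have := hn.1
      exact congrArg Subtype.val (Subsingleton.elim
        (⟨a • x, ⟨a, ha⟩, rfl⟩ : MulAction.orbit A x) ⟨x, MulAction.mem_orbit_self x⟩)
    exact ⟨1, fun a ha => by rw [hfix _ (hconj a ha), zpow_one, hfix a ha]⟩
  · obtain ⟨b, hb⟩ := smul_mem_orbit_of_pow_eq_one (A := A) hq hc
      (by rw [hn, pow_one] : p ≤ Nat.card (MulAction.orbit A x)) hX
    have hb' : (b : G) • x = c • x := hb
    let _ : CommGroup A := { (inferInstance : Group A) with mul_comm := mul_comm' }
    let K : Subgroup A := MulAction.stabilizer A x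
    let φ : A →* A :=
      { toFun := fun a => ⟨c * a * c⁻¹, hconj a a.2⟩
        map_one' := by ext; simp
        map_mul' := fun a b => by ext; simp }
    -- `c⁻¹ • x` is the image of `x` under an element of the commutative group `A`, so both points
    -- have the same stabilizer in `A`.
    have hK : K ≤ K.comap φ := by
      intro a ha
      have ha' : (a : G) • x = x := ha
      change (c * a * c⁻¹) • x = x
      have hd : c⁻¹ * b * c ∈ A := by simpa using ‹A.Normal›.conj_mem b b.2 c⁻¹
      have hx' : c⁻¹ • x = (c⁻¹ * b * c)⁻¹ • x := by
        rw [eq_inv_smul_iff, mul_smul, smul_inv_smul, mul_smul, hb', inv_smul_smul]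
      have hcomm : (a : G) * (c⁻¹ * b * c)⁻¹ = (c⁻¹ * b * c)⁻¹ * a :=
        congrArg Subtype.val (mul_comm a (⟨_, A.inv_mem hd⟩ : A))
      rw [mul_smul, hx', ← mul_smul, mul_assoc, hcomm, mul_smul, mul_smul, ha', ← hx',
        smul_inv_smul]
    have hcard : Nat.card (A ⧸ K) = p := by
      rw [← Nat.card_congr (MulAction.orbitEquivQuotientStabilizer A x), hn, pow_one]
    have : IsCyclic (A ⧸ K) := isCyclic_of_prime_card hcard
    obtain ⟨l, hl⟩ := (QuotientGroup.map K K φ hK).map_cyclic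
    refine ⟨l, fun a ha => ?_⟩
    have h1 := hl ((⟨a, ha⟩ : A) : A ⧸ K)
    rw [QuotientGroup.map_mk, ← QuotientGroup.mk_zpow, QuotientGroup.eq] at h1
    have h2 : ((c * a * c⁻¹)⁻¹ * a ^ l) • x = x := h1
    rw [mul_smul, inv_smul_eq_iff] at h2
    exact h2.symm

/-- At each point both conjugations are power maps, whose exponents multiply commutatively;
faithfulness turns this into an identity in `G`. -/
theorem conj_comm_of_pow_eq_one [FaithfulSMul G X] [IsMulCommutative A] {p q : ℕ} (hp : p.Prime)
    (hq : q.Prime) (hqp : q ≤ p) (hA : ∀ a ∈ A, a ^ p = 1) (hX : Nat.card X < p * q) {c d : G}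
    (hc : c ^ q = 1) (hd : d ^ q = 1) {a : G} (ha : a ∈ A) :
    c * (d * a * d⁻¹) * c⁻¹ = d * (c * a * c⁻¹) * d⁻¹ := by
  have hconj : ∀ c, ∀ a ∈ A, c * a * c⁻¹ ∈ A := fun c a ha => ‹A.Normal›.conj_mem a ha c
  refine eq_of_smul_eq_smul (α := X) fun x => ?_
  obtain ⟨k, hk⟩ := exists_zpow_smul_eq hp hq hqp hA hX hc x
  obtain ⟨l, hl⟩ := exists_zpow_smul_eq hp hq hqp hA hX hd x
  rw [hk _ (hconj d a ha), hl _ (hconj c a ha), conj_zpow, conj_zpow,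
    hk _ (A.zpow_mem ha _), hl _ (A.zpow_mem ha _), ← zpow_mul, ← zpow_mul, mul_comm]

/-- Iterating the power map `q` times gives `l ^ q = 1` modulo the period of `a` at `x`, which is 1
or `p`. In the latter case `l` is a `q`-th root of unity in `ZMod p`, hence 1 by coprimality. -/
theorem conj_eq_self_of_pow_eq_one [FaithfulSMul G X] [IsMulCommutative A] {p q : ℕ}
    (hp : p.Prime) (hq : q.Prime) (hqp : q ≤ p) (hA : ∀ a ∈ A, a ^ p = 1)
    (hX : Nat.card X < p * q) (hpq : q.Coprime (p - 1)) {c : G} (hc : c ^ q = 1) {a : G}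
    (ha : a ∈ A) : c * a * c⁻¹ = a := by
  have hconj : ∀ a ∈ A, c * a * c⁻¹ ∈ A := fun a ha => ‹A.Normal›.conj_mem a ha c
  have : Fact p.Prime := ⟨hp⟩
  refine eq_of_smul_eq_smul (α := X) fun x => ?_
  obtain ⟨l, hl⟩ := exists_zpow_smul_eq hp hq hqp hA hX hc x
  have hpow : ∀ n : ℕ, ∀ b ∈ A, (c ^ n * b * (c ^ n)⁻¹) • x = b ^ (l ^ n) • x := by
    intro n
    induction n with
    | zero => simp
    | succ n ih =>
      intro b hb
      have h1 : c ^ (n + 1) * b * (c ^ (n + 1))⁻¹ = c ^ n * (c * b * c⁻¹) * (c ^ n)⁻¹ := by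
        rw [pow_succ]; group
      rw [h1, ih _ (hconj b hb), conj_zpow, hl _ (A.zpow_mem hb _), ← zpow_mul, pow_succ]
  have hfix : a ^ (l ^ q) • x = a • x := by simpa [hc] using (hpow q a ha).symm
  have hdvd : ∀ m : ℤ, a ^ m • x = a • x ↔
      (Function.minimalPeriod (a • ·) x : ℤ) ∣ m - 1 := by
    intro m
    rw [← MulAction.zpow_smul_eq_iff_minimalPeriod_dvd, sub_eq_neg_add, zpow_add, mul_smul,
      zpow_neg_one, inv_smul_eq_iff]
  rw [hl a ha, hdvd]
  rw [hdvd] at hfix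
  have hperiod : Function.minimalPeriod (a • ·) x ∣ p := by
    rw [← MulAction.pow_smul_eq_iff_minimalPeriod_dvd, hA a ha, one_smul]
  rcases (Nat.dvd_prime hp).mp hperiod with h | h
  · simp [h]
  · rw [h] at hfix ⊢
    have h1 : (l : ZMod p) ^ q = 1 := by
      have := (ZMod.intCast_zmod_eq_zero_iff_dvd _ _).mpr hfix
      push_cast at this
      exact sub_eq_zero.mp this
    have h0 : (l : ZMod p) ≠ 0 := by
      intro h0
      rw [h0, zero_pow hq.ne_zero] at h1
      exact zero_ne_one h1
    have h2 : (l : ZMod p) = 1 := by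
      have := pow_gcd_eq_one.mpr ⟨h1, ZMod.pow_card_sub_one_eq_one h0⟩
      rwa [hpq.gcd_eq_one, pow_one] at this
    rw [← ZMod.intCast_zmod_eq_zero_iff_dvd]
    push_cast
    rw [h2, sub_self]

end NormalPSubgroup

/-! ### Lower bounds for the monomial groups. -/

section MonomialReflectionGroup

open SemidirectProduct

theorem mem_baseGroup_self_iff {m n : ℕ} [NeZero m] {θ : Fin n → Multiplicative (ZMod m)} :
    θ ∈ baseGroup m m n ↔ ∏ i, θ i = 1 := by
  change (∏ i, θ i) ^ (m / m) = 1 ↔ _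
  rw [Nat.div_self (NeZero.pos m), pow_one]

instance (m p n : ℕ) : IsMulCommutative (inl : baseGroup m p n →*
    monomialReflectionGroup m p n).range := by
  refine ⟨⟨?_⟩⟩
  rintro ⟨_, a, rfl⟩ ⟨_, b, rfl⟩
  ext1
  change inl a * inl b = inl b * inl a
  rw [← map_mul, ← map_mul]
  congr 1
  ext1
  exact mul_comm _ _

instance (m p n : ℕ) : (inl : baseGroup m p n →* monomialReflectionGroup m p n).range.Normal := by
  rw [range_inl_eq_ker_rightHom]
  infer_instance

theorem permAction_faithful {m n : ℕ} (hm : 1 < m) (hn : 2 < n) {σ τ : Equiv.Perm (Fin n)}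
    (h : ∀ θ, permAction m m n σ θ = permAction m m n τ θ) : σ = τ := by
  have : NeZero m := ⟨by omega⟩
  by_contra hne
  obtain ⟨j, hj⟩ : ∃ j, σ⁻¹ j ≠ τ⁻¹ j := by
    by_contra! hj
    exact hne (inv_injective (Equiv.ext hj))
  obtain ⟨k, hk1, hk2⟩ : ∃ k, k ≠ σ⁻¹ j ∧ k ≠ τ⁻¹ j := by
    obtain ⟨k, hk⟩ := Finset.exists_mem_notMem_of_card_lt_card (s := {σ⁻¹ j, τ⁻¹ j})
      (t := Finset.univ) (by
        rw [Finset.card_univ, Fintype.card_fin]; exact Finset.card_le_two.trans_lt hn)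
    exact ⟨k, by simpa using hk.2⟩
  set g : Multiplicative (ZMod m) := Multiplicative.ofAdd 1
  have hg : g ≠ 1 := by
    have : Fact (1 < m) := ⟨hm⟩
    exact fun h => one_ne_zero (α := ZMod m) (Multiplicative.ofAdd.injective h)
  -- The entry at the third index `k` makes the product 1 without affecting the two coordinates
  -- compared; this is where `2 < n` enters.
  let θ : baseGroup m m n := ⟨Pi.mulSingle (σ⁻¹ j) g * Pi.mulSingle k g⁻¹, by
    rw [mem_baseGroup_self_iff]
    simp only [Pi.mul_apply, Finset.prod_mul_distrib, Finset.prod_pi_mulSingle']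
    simp⟩
  have h1 := congrFun (congrArg Subtype.val (h θ)) j
  change θ.1 (σ⁻¹ j) = θ.1 (τ⁻¹ j) at h1
  simp only [θ, Pi.mul_apply, Pi.mulSingle_eq_same, Pi.mulSingle_eq_of_ne hk1.symm,
    Pi.mulSingle_eq_of_ne hk2.symm, Pi.mulSingle_eq_of_ne hj.symm, mul_one] at h1
  exact hg h1

theorem addRight_one_pow_self (n : ℕ) [NeZero n] : Equiv.addRight (1 : Fin n) ^ n = 1 := by
  have h : ∀ (k : ℕ) (i : Fin n), (Equiv.addRight (1 : Fin n) ^ k) i = i + k • 1 := by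
    intro k i
    induction k with
    | zero => simp
    | succ k ih =>
      rw [pow_succ', Equiv.Perm.mul_apply, ih, succ_nsmul, ← add_assoc]
      rfl
  ext i
  have hn : n • (1 : Fin n) = 0 := by simpa using card_nsmul_eq_zero' (x := (1 : Fin n))
  rw [h, hn, add_zero, Equiv.Perm.one_apply]

theorem exists_perm_not_commute {n : ℕ} (hn : 3 < n) :
    ∃ σ τ : Equiv.Perm (Fin n), σ ^ n = 1 ∧ τ ^ n = 1 ∧ σ * τ ≠ τ * σ := by
  have : NeZero n := ⟨by omega⟩
  let σ : Equiv.Perm (Fin n) := Equiv.addRight 1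
  have hσ : σ ^ n = 1 := addRight_one_pow_self n
  have hval : ∀ i : Fin n, σ i = i + 1 := fun _ => rfl
  let s : Equiv.Perm (Fin n) := Equiv.swap 0 1
  have h2 : (1 + 1 : Fin n) ≠ 0 ∧ (1 + 1 : Fin n) ≠ 1 ∧ (1 + 1 + 1 : Fin n) ≠ 0 := by
    refine ⟨?_, ?_, ?_⟩ <;>
    simp [Fin.ext_iff, Fin.val_add, Nat.mod_eq_of_lt (show 1 < n by omega),
      Nat.mod_eq_of_lt (show 1 + 1 < n by omega), Nat.mod_eq_of_lt hn]
  -- The two products send 0 to 3 and to 0 respectively; these differ since `3 < n`.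
  refine ⟨σ, s * σ * s⁻¹, hσ, by rw [conj_pow, hσ]; simp, fun h => h2.2.2 ?_⟩
  have := Equiv.congr_fun h 0
  simpa [s, hval, Equiv.swap_apply_of_ne_of_ne h2.1 h2.2.1] using this

theorem inl_pow_eq_one {m p n : ℕ} :
    ∀ a ∈ (inl : baseGroup m p n →* monomialReflectionGroup m p n).range, a ^ m = 1 := by
  rintro _ ⟨θ, rfl⟩
  rw [← map_pow]
  have : θ ^ m = 1 := by
    ext i
    change ((θ : Fin n → Multiplicative (ZMod m)) i) ^ m = 1
    apply Multiplicative.toAdd.injective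
    simp
  rw [this, map_one]

theorem mul_le_of_injective {p q : ℕ} (hp : p.Prime) (hq : q.Prime) (hq2 : 2 < q) (hqp : q < p)
    (h : 5 ≤ q ∨ q.Coprime (p - 1)) {k : ℕ}
    {f : monomialReflectionGroup p p q →* Equiv.Perm (Fin k)} (hf : Function.Injective f) :
    p * q ≤ k := by
  by_contra! hk
  let _ : MulAction (monomialReflectionGroup p p q) (Fin k) := MulAction.compHom _ f
  have : FaithfulSMul (monomialReflectionGroup p p q) (Fin k) :=
    ⟨fun h => hf (Equiv.ext h)⟩
  have hX : Nat.card (Fin k) < p * q := by rwa [Nat.card_fin]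
  rcases h with h | h
  · obtain ⟨σ, τ, hσ, hτ, hne⟩ := exists_perm_not_commute (show 3 < q by omega)
    refine hne (permAction_faithful hp.one_lt hq2 fun θ => ?_)
    have := conj_comm_of_pow_eq_one hp hq hqp.le inl_pow_eq_one hX
      (c := (inr σ : monomialReflectionGroup p p q)) (d := inr τ)
      (by rw [← map_pow, hσ, map_one]) (by rw [← map_pow, hτ, map_one]) ⟨θ, rfl⟩
    rw [← map_inv, ← map_inv, ← inl_aut, ← inl_aut, ← inl_aut, ← inl_aut] at this
    simpa using inl_injective this
  · have : NeZero q := ⟨hq.ne_zero⟩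
    let σ : Equiv.Perm (Fin q) := Equiv.addRight 1
    have hσ : σ ^ q = 1 := addRight_one_pow_self q
    have hσ1 : σ = 1 := permAction_faithful hp.one_lt hq2 fun θ => by
      have := conj_eq_self_of_pow_eq_one hp hq hqp.le inl_pow_eq_one hX h
        (c := (inr σ : monomialReflectionGroup p p q))
        (by rw [← map_pow, hσ, map_one]) ⟨θ, rfl⟩
      rw [← map_inv, ← inl_aut] at this
      simpa using inl_injective this
    have h01 : (0 + 1 : Fin q) = 0 := Equiv.congr_fun hσ1 0
    rw [zero_add, Fin.ext_iff, Fin.val_one', Fin.val_zero, Nat.mod_eq_of_lt hq.one_lt] at h01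
    exact one_ne_zero h01

/-- The first two coordinates are free in `A(p,p,3)`, so `C_p × C_p` embeds in `Sym(k)` and `p ^ 2 ∣
k!`. -/
theorem two_mul_le_of_injective {p k : ℕ} (hp : p.Prime) (hp2 : 2 < p)
    {f : monomialReflectionGroup p p 3 →* Equiv.Perm (Fin k)} (hf : Function.Injective f) :
    2 * p ≤ k := by
  have : NeZero p := ⟨hp.ne_zero⟩
  by_contra! hk
  let v : Multiplicative (ZMod p) × Multiplicative (ZMod p) →
      Fin 3 → Multiplicative (ZMod p) := fun z => ![z.1, z.2, (z.1 * z.2)⁻¹]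
  have hv : ∀ z, v z ∈ baseGroup p p 3 := fun z => by
    rw [mem_baseGroup_self_iff, Fin.prod_univ_three]
    exact mul_inv_cancel _
  have hv1 : v 1 = 1 := by
    simp only [v, Prod.fst_one, Prod.snd_one, mul_one, inv_one]
    exact funext (Fin.forall_fin_succ.mpr ⟨rfl, Fin.forall_fin_two.mpr ⟨rfl, rfl⟩⟩)
  have hvmul : ∀ x y, v (x * y) = v x * v y := fun x y => by
    simp only [v, Prod.fst_mul, Prod.snd_mul, mul_inv]
    exact funext (Fin.forall_fin_succ.mpr ⟨rfl, Fin.forall_fin_two.mpr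
      ⟨rfl, mul_mul_mul_comm x.1⁻¹ y.1⁻¹ x.2⁻¹ y.2⁻¹⟩⟩)
  let g : Multiplicative (ZMod p) × Multiplicative (ZMod p) →* baseGroup p p 3 :=
    { toFun := fun z => ⟨v z, hv z⟩
      map_one' := Subtype.ext hv1
      map_mul' := fun x y => Subtype.ext (hvmul x y) }
  have hg : Function.Injective g := fun x y h => by
    have h' : v x = v y := congrArg Subtype.val h
    have h0 : x.1 = y.1 := congrFun h' 0
    have h1 : x.2 = y.2 := congrFun h' 1
    exact Prod.ext h0 h1
  have hdvd := Subgroup.card_dvd_of_injective ((f.comp inl).comp g)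
    ((hf.comp inl_injective).comp hg)
  have hcard : Nat.card (Multiplicative (ZMod p)) = p := Nat.card_zmod p
  -- Since `k < 2 * p < p ^ 2`, Legendre's formula for `k!` has the single term `k / p`.
  rw [Nat.card_prod, hcard, Nat.card_perm, Nat.card_fin, ← sq,
    hp.pow_dvd_factorial_iff (b := 2) (Nat.log_lt_of_lt_pow' (by norm_num) (by nlinarith))] at hdvd
  simp only [Nat.Ico_succ_singleton, Finset.sum_singleton, pow_one] at hdvd
  rw [Nat.le_div_iff_mul_le hp.pos] at hdvd
  omega

end MonomialReflectionGroup

/-! ### Faithful actions on `m * n` and on `2 * p` points. -/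

section UpperBound

open SemidirectProduct

theorem minPermDegree_le_of_faithful (G X : Type*) [Group G] [MulAction G X] [FaithfulSMul G X]
    [Finite X] : minPermDegree G ≤ Nat.card X :=
  Nat.sInf_le ⟨((Finite.equivFin X).permCongrHom.toMonoidHom).comp (MulAction.toPermHom G X),
    (Finite.equivFin X).permCongrHom.injective.comp MulAction.toPerm_injective⟩

/-- Monomial matrices permute the vectors whose only nonzero entry is an `m`-th root of unity. -/
theorem minPermDegree_monomialReflectionGroup_le (m p n : ℕ) [NeZero m] [NeZero n] :
    minPermDegree (monomialReflectionGroup m p n) ≤ m * n := by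
  let _ : MulAction (monomialReflectionGroup m p n) (Fin n × Multiplicative (ZMod m)) :=
    { smul := fun g x => (g.right x.1, g.left.1 (g.right x.1) * x.2)
      one_smul := fun x => Prod.ext rfl (one_mul _)
      mul_smul := fun g h x => by
        refine Prod.ext rfl ?_
        change g.left.1 (g.right (h.right x.1)) *
          h.left.1 (g.right.symm (g.right (h.right x.1))) * x.2 = _
        rw [Equiv.symm_apply_apply, mul_assoc]
        rfl }
  have : FaithfulSMul (monomialReflectionGroup m p n) (Fin n × Multiplicative (ZMod m)) := by
    refine ⟨fun {g h} H => ?_⟩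
    have hr : g.right = h.right := Equiv.ext fun i => congrArg Prod.fst (H (i, 1))
    refine SemidirectProduct.ext (Subtype.ext (funext fun i => ?_)) hr
    obtain ⟨j, rfl⟩ := g.right.surjective i
    have h2 : g.left.1 (g.right j) * 1 = h.left.1 (h.right j) * 1 :=
      congrArg Prod.snd (H (j, 1))
    rwa [← hr, mul_one, mul_one] at h2
  refine (minPermDegree_le_of_faithful _ (Fin n × Multiplicative (ZMod m))).trans_eq ?_
  have hcard : Nat.card (Multiplicative (ZMod m)) = m := Nat.card_zmod m
  rw [Nat.card_prod, Nat.card_fin, hcard, mul_comm]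

/-- `Sym(3)` is the affine group of `ZMod 3`, the slope being the sign. -/
theorem perm_fin_three_apply (σ : Equiv.Perm (Fin 3)) (i : Fin 3) :
    ((σ i : ℕ) : ZMod 3) = ((Equiv.Perm.sign σ : ℤ) : ZMod 3) * (i : ℕ) + (σ 0 : ℕ) := by
  revert σ i
  decide

/-- The `u`-eigenfunctional of the cyclic shift on `A(p,p,3)` attached to a character `χ` of
`ZMod 3`. -/
def shiftFunctional {p : ℕ} (χ : AddChar (ZMod 3) (ZMod p)) (u : ℤˣ)
    (θ : baseGroup p p 3) : ZMod p :=
  ∑ i : Fin 3, χ (((u : ℤ) : ZMod 3) * ((i : ℕ) : ZMod 3)) * (θ.1 i).toAdd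

theorem shiftFunctional_mul {p : ℕ} (χ : AddChar (ZMod 3) (ZMod p)) (u : ℤˣ)
    (θ η : baseGroup p p 3) :
    shiftFunctional χ u (θ * η) = shiftFunctional χ u θ + shiftFunctional χ u η := by
  simp only [shiftFunctional, ← Finset.sum_add_distrib, ← mul_add]
  rfl

/-- Reindexing the sum by the affine map `σ`: its slope exchanges the two functionals when `σ` is
odd, and its translation part contributes a scalar value of `χ`. -/
theorem shiftFunctional_permAction {p : ℕ} (χ : AddChar (ZMod 3) (ZMod p)) (u : ℤˣ)
    (σ : Equiv.Perm (Fin 3)) (θ : baseGroup p p 3) :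
    shiftFunctional χ (Equiv.Perm.sign σ * u) (permAction p p 3 σ θ) =
      χ (((Equiv.Perm.sign σ * u : ℤˣ) : ℤ) * ((σ 0 : ℕ) : ZMod 3)) * shiftFunctional χ u θ := by
  unfold shiftFunctional
  rw [← Equiv.sum_comp σ, Finset.mul_sum]
  refine Finset.sum_congr rfl fun i _ => ?_
  have h1 : ((permAction p p 3 σ θ).1 (σ i)) = θ.1 i := by
    change θ.1 (σ.symm (σ i)) = _
    rw [Equiv.symm_apply_apply]
  have hs : (((Equiv.Perm.sign σ : ℤˣ) : ℤ) : ZMod 3) * ((Equiv.Perm.sign σ : ℤˣ) : ℤ) = 1 := by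
    rw [← Int.cast_mul, ← Units.val_mul, Int.units_mul_self, Units.val_one, Int.cast_one]
  rw [h1, ← mul_assoc, ← AddChar.map_add_eq_mul]
  congr 2
  have h2 : ((σ i : ℕ) : ZMod 3) = ((Equiv.Perm.sign σ : ℤ) : ZMod 3) * ((i : ℕ) : ZMod 3) + ((σ 0 : ℕ) : ZMod 3) :=
    perm_fin_three_apply σ i
  rw [h2]
  push_cast
  linear_combination ((u : ℤ) : ZMod 3) * ((i : ℕ) : ZMod 3) * hs

/-- The coordinate sum, zero on `A(p,p,3)`, and the two functionals form the Fourier transform of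
`θ` over `ZMod 3`, invertible because 3 is a unit in `ZMod p`. -/
theorem eq_one_of_shiftFunctional_eq_zero {p : ℕ} [Fact p.Prime] (hp3 : p ≠ 3)
    {χ : AddChar (ZMod 3) (ZMod p)} (hχ : χ 1 ≠ 1) {θ : baseGroup p p 3}
    (h1 : shiftFunctional χ 1 θ = 0) (h2 : shiftFunctional χ (-1) θ = 0) : θ = 1 := by
  set w := χ 1
  have hw2 : χ 2 = w ^ 2 := by
    rw [show (2 : ZMod 3) = 1 + 1 by rfl, AddChar.map_add_eq_mul, sq]
  have hw3 : w ^ 3 = 1 := by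
    rw [pow_succ, ← hw2, ← AddChar.map_add_eq_mul, show (2 + 1 : ZMod 3) = 0 by rfl,
      AddChar.map_zero_eq_one]
  have hw : w ^ 2 + w + 1 = 0 := by
    have : (w - 1) * (w ^ 2 + w + 1) = 0 := by linear_combination hw3
    exact (mul_eq_zero.mp this).resolve_left (sub_ne_zero.mpr hχ)
  have h3 : (3 : ZMod p) ≠ 0 := by
    intro h
    have : p ∣ 3 := (ZMod.natCast_eq_zero_iff 3 p).mp (by exact_mod_cast h)
    exact hp3 ((Nat.prime_dvd_prime_iff_eq Fact.out Nat.prime_three).mp this)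
  have h0 : (θ.1 0).toAdd + (θ.1 1).toAdd + (θ.1 2).toAdd = 0 := by
    have := mem_baseGroup_self_iff.mp θ.2
    rw [Fin.prod_univ_three] at this
    exact congrArg Multiplicative.toAdd this
  set t := fun i => (θ.1 i).toAdd
  have h1' : t 0 + w * t 1 + w ^ 2 * t 2 = 0 := by
    rw [← hw2, ← h1, shiftFunctional, Fin.sum_univ_three]
    change _ = χ 0 * t 0 + χ 1 * t 1 + χ 2 * t 2
    rw [AddChar.map_zero_eq_one, one_mul]
  have h2' : t 0 + w ^ 2 * t 1 + w * t 2 = 0 := by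
    rw [← hw2, ← h2, shiftFunctional, Fin.sum_univ_three]
    change _ = χ 0 * t 0 + χ 2 * t 1 + χ 1 * t 2
    rw [AddChar.map_zero_eq_one, one_mul]
  have h0' : t 0 + t 1 + t 2 = 0 := h0
  have e0 : t 0 = 0 := by
    have : 3 * t 0 = 0 := by linear_combination h0' + h1' + h2' - (t 1 + t 2) * hw
    exact (mul_eq_zero.mp this).resolve_left h3
  have e1 : t 1 = 0 := by
    have : 3 * t 1 = 0 := by
      linear_combination h0' + w ^ 2 * h1' + w * h2' - (t 0) * hw - (2 * t 1 + (w + 1) * t 2) * hw3 +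
        t 2 * hw3 - t 2 * hw
    exact (mul_eq_zero.mp this).resolve_left h3
  have e2 : t 2 = 0 := by linear_combination h0' - e0 - e1
  ext i
  apply Multiplicative.toAdd.injective
  fin_cases i
  exacts [e0, e1, e2]

theorem exists_addChar_zmod_three {p : ℕ} (hp : p.Prime) (h : p ≡ 1 [MOD 3]) :
    ∃ χ : AddChar (ZMod 3) (ZMod p), χ 1 ≠ 1 := by
  have : Fact p.Prime := ⟨hp⟩
  have : Fact (Nat.Prime 3) := ⟨Nat.prime_three⟩
  have hdvd : 3 ∣ Nat.card (ZMod p)ˣ := by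
    rw [Nat.card_eq_fintype_card, ZMod.card_units]
    exact (Nat.modEq_iff_dvd' hp.one_lt.le).mp h.symm
  obtain ⟨ζ, hζ⟩ := exists_prime_orderOf_dvd_card' 3 hdvd
  have hζ3 : (ζ : ZMod p) ^ 3 = 1 := by
    rw [← Units.val_pow_eq_pow_val, ← hζ, pow_orderOf_eq_one, Units.val_one]
  refine ⟨AddChar.zmodChar 3 hζ3, fun h => ?_⟩
  have h1 : (ζ : ZMod p) ^ 1 = 1 := h
  rw [pow_one, Units.val_eq_one] at h1
  rw [h1, orderOf_one] at hζ
  omega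

theorem minPermDegree_monomialReflectionGroup_three_le {p : ℕ} (hp : p.Prime)
    (h : p ≡ 1 [MOD 3]) : minPermDegree (monomialReflectionGroup p p 3) ≤ 2 * p := by
  have : Fact p.Prime := ⟨hp⟩
  have hp3 : p ≠ 3 := by rintro rfl; exact absurd h (by decide)
  obtain ⟨χ, hχ⟩ := exists_addChar_zmod_three hp h
  -- The sign of the permutation moves between the two copies of `ZMod p`; between copies the map is
  -- affine, translating by the functional of the target copy.
  let _ : MulAction (monomialReflectionGroup p p 3) (ℤˣ × ZMod p) :=
    { smul := fun g x => (Equiv.Perm.sign g.right * x.1,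
        shiftFunctional χ (Equiv.Perm.sign g.right * x.1) g.left +
          χ (((Equiv.Perm.sign g.right * x.1 : ℤˣ) : ℤ) * ((g.right 0 : ℕ) : ZMod 3)) * x.2)
      one_smul := fun x => by
        refine Prod.ext (one_mul _) ?_
        change (∑ i : Fin 3, _ * 0) + χ (_ * ((0 : ℕ) : ZMod 3)) * x.2 = x.2
        simp
      mul_smul := fun g h x => by
        have hsign : Equiv.Perm.sign (g.right * h.right) * x.1 =
            Equiv.Perm.sign g.right * (Equiv.Perm.sign h.right * x.1) := by
          rw [map_mul, mul_assoc]
        refine Prod.ext hsign ?_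
        change shiftFunctional χ (Equiv.Perm.sign (g.right * h.right) * x.1)
            (g.left * permAction p p 3 g.right h.left) +
          χ (((Equiv.Perm.sign (g.right * h.right) * x.1 : ℤˣ) : ℤ) *
            (((g.right * h.right) 0 : ℕ) : ZMod 3)) * x.2 =
          shiftFunctional χ (Equiv.Perm.sign g.right * (Equiv.Perm.sign h.right * x.1)) g.left +
          χ (((Equiv.Perm.sign g.right * (Equiv.Perm.sign h.right * x.1) : ℤˣ) : ℤ) *
            ((g.right 0 : ℕ) : ZMod 3)) *
          (shiftFunctional χ (Equiv.Perm.sign h.right * x.1) h.left +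
            χ (((Equiv.Perm.sign h.right * x.1 : ℤˣ) : ℤ) * ((h.right 0 : ℕ) : ZMod 3)) * x.2)
        rw [hsign, shiftFunctional_mul, shiftFunctional_permAction, mul_add, add_assoc,
          ← mul_assoc (χ _) (χ _), ← AddChar.map_add_eq_mul]
        congr 4
        have h2 : (((g.right * h.right) 0 : ℕ) : ZMod 3) =
            ((Equiv.Perm.sign g.right : ℤ) : ZMod 3) * ((h.right 0 : ℕ) : ZMod 3) +
              ((g.right 0 : ℕ) : ZMod 3) := perm_fin_three_apply g.right (h.right 0)
        have hs : (((Equiv.Perm.sign g.right : ℤˣ) : ℤ) : ZMod 3) *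
            ((Equiv.Perm.sign g.right : ℤˣ) : ℤ) = 1 := by
          rw [← Int.cast_mul, ← Units.val_mul, Int.units_mul_self, Units.val_one, Int.cast_one]
        rw [h2]
        push_cast
        linear_combination ((Equiv.Perm.sign h.right : ℤ) : ZMod 3) * ((x.1 : ℤ) : ZMod 3) *
          ((h.right 0 : ℕ) : ZMod 3) * hs }
  have hker : ∀ g : monomialReflectionGroup p p 3, (∀ x : ℤˣ × ZMod p, g • x = x) → g = 1 := by
    intro g hg
    have hsign : Equiv.Perm.sign g.right = 1 := by
      have := congrArg Prod.fst (hg (1, 0))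
      change Equiv.Perm.sign g.right * 1 = 1 at this
      rwa [mul_one] at this
    have hsnd : ∀ (u : ℤˣ) (z : ZMod p), shiftFunctional χ u g.left +
        χ (((u : ℤˣ) : ℤ) * ((g.right 0 : ℕ) : ZMod 3)) * z = z := by
      intro u z
      have : shiftFunctional χ (Equiv.Perm.sign g.right * u) g.left +
        χ (((Equiv.Perm.sign g.right * u : ℤˣ) : ℤ) * ((g.right 0 : ℕ) : ZMod 3)) * z = z :=
        congrArg Prod.snd (hg (u, z))
      rwa [hsign, one_mul] at this
    have hzero : ∀ u : ℤˣ, shiftFunctional χ u g.left = 0 := fun u => by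
      simpa using hsnd u 0
    have hleft : g.left = 1 := eq_one_of_shiftFunctional_eq_zero hp3 hχ (hzero 1) (hzero (-1))
    have hχ0 : χ ((g.right 0 : ℕ) : ZMod 3) = 1 := by simpa [hzero] using hsnd 1 1
    have h0 : ((g.right 0 : ℕ) : ZMod 3) = 0 := by
      -- The last case is `v = 2`, written so that `χ 1 = χ v * χ v`.
      have hcases : ∀ v : ZMod 3, v = 0 ∨ v = 1 ∨ v + v = 1 := by decide
      rcases hcases ((g.right 0 : ℕ) : ZMod 3) with h | h | h
      · exact h
      · exact absurd (h ▸ hχ0) hχ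
      · exact absurd (by
          rw [← h, AddChar.map_add_eq_mul, hχ0, one_mul]) hχ
    refine SemidirectProduct.ext hleft (Equiv.ext fun i => ?_)
    have h2 : ((g.right i : ℕ) : ZMod 3) =
      ((Equiv.Perm.sign g.right : ℤ) : ZMod 3) * ((i : ℕ) : ZMod 3) + ((g.right 0 : ℕ) : ZMod 3) :=
      perm_fin_three_apply g.right i
    rw [h0, hsign, Units.val_one, Int.cast_one, one_mul, add_zero] at h2
    have hinj : ∀ a b : Fin 3, ((a : ℕ) : ZMod 3) = ((b : ℕ) : ZMod 3) → a = b := by decide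
    exact hinj _ _ h2
  have : FaithfulSMul (monomialReflectionGroup p p 3) (ℤˣ × ZMod p) := by
    refine ⟨fun {g h} H => ?_⟩
    rw [← inv_mul_eq_one]
    exact hker _ fun x => by rw [mul_smul, inv_smul_eq_iff, H]
  refine (minPermDegree_le_of_faithful _ (ℤˣ × ZMod p)).trans_eq ?_
  rw [Nat.card_prod, Nat.card_zmod, Nat.card_eq_fintype_card, Fintype.card_units_int]

end UpperBound

theorem theorem3p4 (p q : ℕ) (hp : p.Prime) (hq : q.Prime) (hp2 : Odd p) (hq2 : Odd q)
    (hpq : q < p) :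
    (5 ≤ q ∨ (q = 3 ∧ p ≡ 2 [MOD 3]) →
      minPermDegree (monomialReflectionGroup p p q) = p * q) ∧
    (q = 3 ∧ p ≡ 1 [MOD 3] →
      minPermDegree (monomialReflectionGroup p p q) = 2 * p) := by
  have : NeZero p := ⟨hp.ne_zero⟩
  have : NeZero q := ⟨hq.ne_zero⟩
  obtain ⟨f, hf⟩ := (minPermDegree_isLeast (monomialReflectionGroup p p q)).1
  have hq3 : 2 < q := lt_of_le_of_ne hq.two_le (by rintro rfl; exact absurd hq2 (by decide))
  refine ⟨fun h => le_antisymm (minPermDegree_monomialReflectionGroup_le p p q)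
    (mul_le_of_injective hp hq hq3 hpq (h.imp_right ?_) hf), ?_⟩
  · rintro ⟨rfl, hmod⟩
    rw [Nat.Prime.coprime_iff_not_dvd hq]
    have h' : p % 3 = 2 % 3 := hmod
    omega
  · rintro ⟨rfl, h⟩
    exact le_antisymm (minPermDegree_monomialReflectionGroup_three_le hp h)
      (two_mul_le_of_injective hp (by omega) hf)
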